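/- For a real number $x$ and an integer $n\ge 0$ put $S_n(x)=\sum_{j=1}^{n}(-1)^{\lfloor jx\rfloor}$; an integer $n\ge 0$ is a zero of the walk if $S_n(x)=0$. Let $\xi$ be an irrational real number with regular continued fraction $\xi=[a_0;a_1,a_2,\dots]$ and let $q_n$ be the denominator of the convergent $p_n/q_n=[a_0;a_1,\dots,a_n]$, so that $q_0=1$. The $\xi$-Ostrowski digits of an integer $N\ge 0$ are the unique finitely supported sequence $(b_i)_{i\ge 0}$ of non-negative integers with $N=\sum_i b_iq_i$, $b_0<a_1$, and for all $i\ge 1$: $b_i\le a_{i+1}$, and $b_i=a_{i+1}$ implies $b_{i-1}=0$. A set of non-negative integers is called $\xi$-Ostrowski automatic if some deterministic automaton with finitely many states, reading words $b_{L-1}\cdots b_1b_0$ of digits with the most significant digit first, decides membership in the set: for every $N$ with $\xi$-Ostrowski digits $(b_i)$ and every $L$ such that $b_i=0$ for all $i\ge L$, it accepts $b_{L-1}\cdots b_1b_0$ if and only if $N$ is in the set. (The letters are non-negative integers. No condition is imposed on words that do not represent a number.) Call $\xi$ a BR-number if $q_{2n+1}$ is even for all $n\ge 0$. **Corollary.**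 If $\xi$ is a BR-number, then the set of zeros $\{n\ge 0 : S_n(2\xi)=0\}$ is $\xi$-Ostrowski automatic. Moreover, there is a deterministic automaton with finitely many states that accepts exactly the words $b_{L-1}\cdots b_1b_0$ over the non-negative integers with $b_i=0$ for all even $i$, and this automaton decides in the above sense whether $n$ is a zero of $S_n(2\xi)$. -/

import Mathlib

/-- The deterministic random walk `S_n(ξ) = ∑_{j=1}^n (-1)^⌊jξ⌋`. -/
noncomputable def detWalk (ξ : ℝ) (n : ℕ) : ℤ :=
  ∑ j ∈ Finset.Icc 1 n, ((⌊(j : ℝ) * ξ⌋).negOnePow : ℤ)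

/-- The partial quotient `a_i` of the regular continued fraction `ξ = [a_0; a_1, a_2, …]`
(for irrational `ξ` the stream never stops, so the default value is not used). -/
noncomputable def cfQuot (ξ : ℝ) (i : ℕ) : ℤ :=
  ((GenContFract.IntFractPair.stream ξ i).map GenContFract.IntFractPair.b).getD 0

/-- The denominator `q_i` of the convergent `p_i / q_i = [a_0; a_1, …, a_i]`, starting from
`q_0 = 1`, as a natural number. Mathlib's `dens` is real-valued, but takes integer values. -/
noncomputable def cfDen (ξ : ℝ) (i : ℕ) : ℕ := ⌊(GenContFract.of ξ).dens i⌋₊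

/-- `ξ` is a BR-number: the denominators `q_1, q_3, q_5, …` are all even. -/
def IsBRNumber (ξ : ℝ) : Prop := ∀ n : ℕ, Even (cfDen ξ (2 * n + 1))

/-- `(b_i)` is the digit sequence of `N` in `ξ`-Ostrowski numeration. -/
structure IsOstrowskiRep (ξ : ℝ) (b : ℕ →₀ ℕ) (N : ℕ) : Prop where
  digit_zero : (b 0 : ℤ) < cfQuot ξ 1
  digit_le : ∀ i, 1 ≤ i → (b i : ℤ) ≤ cfQuot ξ (i + 1)
  digit_eq : ∀ i, 1 ≤ i → (b i : ℤ) = cfQuot ξ (i + 1) → b (i - 1) = 0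
  sum_eq : N = b.sum fun i d => d * cfDen ξ i

/-- The word `b_{L-1} … b_1 b_0`, most significant digit first. -/
def msdWord (b : ℕ → ℕ) (L : ℕ) : List ℕ := ((List.range L).map b).reverse

/-- The automaton `M`, reading the `ξ`-Ostrowski digits of a number with the most significant
digit first (possibly with leading zeros), decides whether the number is in `s`. -/
def OstrowskiDecides (ξ : ℝ) {σ : Type} (M : DFA ℕ σ) (s : Set ℕ) : Prop :=
  ∀ (N : ℕ) (b : ℕ →₀ ℕ) (L : ℕ), IsOstrowskiRep ξ b N → (∀ i, L ≤ i → b i = 0) →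
    (msdWord b L ∈ M.accepts ↔ N ∈ s)

/-- `s` is `ξ`-Ostrowski automatic: a deterministic automaton with finitely many states decides
membership in `s`. The input letters are digits. If the partial quotients of `ξ` are bounded,
then only finitely many letters occur in representations; in any case, since there are only
finitely many maps from the states to the states, the transition function factors through a
finite quotient of the alphabet. -/
def IsOstrowskiAutomatic (ξ : ℝ) (s : Set ℕ) : Prop :=
  ∃ (σ : Type) (_ : Finite σ) (M : DFA ℕ σ), OstrowskiDecides ξ M s

/-- In the word `w = b_{L-1} … b_1 b_0`, all digits `b_i` with `i` even are zero. -/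
def EvenPositionsZero (w : List ℕ) : Prop :=
  ∀ i, Even i → w.reverse.getD i 0 = 0

section Existence

/-! Every natural number has exactly one representation in `ξ`-Ostrowski numeration. -/

theorem cfQuot_stream {ξ : ℝ} (hξ : Irrational ξ) (n : ℕ) :
    ∃ p, GenContFract.IntFractPair.stream ξ n = some p ∧ p.b = cfQuot ξ n := by
  rcases h : GenContFract.IntFractPair.stream ξ n with _ | p
  · exfalso
    obtain ⟨m, rfl⟩ : ∃ m, n = m + 1 := by
      cases n with
      | zero => simp [GenContFract.IntFractPair.stream_zero] at h
      | succ m => exact ⟨m, rfl⟩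
    have ht : (GenContFract.of ξ).Terminates :=
      ⟨m, GenContFract.of_terminatedAt_n_iff_succ_nth_intFractPair_stream_eq_none.2 h⟩
    obtain ⟨q, hq⟩ := (GenContFract.terminates_iff_rat ξ).1 ht
    exact hξ ⟨q, hq.symm⟩
  · exact ⟨p, rfl, by simp [cfQuot, h]⟩

theorem cfQuot_pos {ξ : ℝ} (hξ : Irrational ξ) (n : ℕ) : 1 ≤ cfQuot ξ (n + 1) := by
  obtain ⟨p, hp, hb⟩ := cfQuot_stream hξ (n + 1)
  exact hb ▸ GenContFract.IntFractPair.one_le_succ_nth_stream_b hp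

theorem cf_get {ξ : ℝ} (hξ : Irrational ξ) (n : ℕ) :
    (GenContFract.of ξ).s.get? n = some ⟨1, (cfQuot ξ (n + 1) : ℝ)⟩ := by
  obtain ⟨p, hp, hb⟩ := cfQuot_stream hξ (n + 1)
  rw [← hb]
  exact GenContFract.get?_of_eq_some_of_succ_get?_intFractPair_stream hp

theorem dens_rec {ξ : ℝ} (hξ : Irrational ξ) (n : ℕ) :
    (GenContFract.of ξ).dens (n + 2) =
      cfQuot ξ (n + 2) * (GenContFract.of ξ).dens (n + 1) + (GenContFract.of ξ).dens n := by
  rw [GenContFract.dens_recurrence (cf_get hξ (n + 1)) rfl rfl]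
  simp

theorem dens_zero_one {ξ : ℝ} (hξ : Irrational ξ) :
    (GenContFract.of ξ).dens 0 = 1 ∧ (GenContFract.of ξ).dens 1 = cfQuot ξ 1 := by
  refine ⟨GenContFract.zeroth_den_eq_one, ?_⟩
  rw [GenContFract.first_den_eq (cf_get hξ 0)]

theorem cast_cfDen {ξ : ℝ} (hξ : Irrational ξ) (n : ℕ) :
    (cfDen ξ n : ℝ) = (GenContFract.of ξ).dens n := by
  have key : ∀ n, (∃ m : ℤ, (GenContFract.of ξ).dens n = m) ∧
      ∃ m : ℤ, (GenContFract.of ξ).dens (n + 1) = m := by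
    intro n
    induction n with
    | zero => exact ⟨⟨1, by simp [(dens_zero_one hξ).1]⟩, ⟨_, (dens_zero_one hξ).2⟩⟩
    | succ n ih =>
      obtain ⟨⟨m, hm⟩, ⟨m', hm'⟩⟩ := ih
      refine ⟨⟨m', hm'⟩, ⟨cfQuot ξ (n + 2) * m' + m, ?_⟩⟩
      rw [dens_rec hξ, hm, hm']
      push_cast
      rfl
  obtain ⟨m, hm⟩ := (key n).1
  have h0 : 0 ≤ (GenContFract.of ξ).dens n := GenContFract.zero_le_of_den
  rw [hm] at h0
  lift m to ℕ using by exact_mod_cast h0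
  simp [cfDen, hm]

theorem cfDen_zero {ξ : ℝ} (hξ : Irrational ξ) : cfDen ξ 0 = 1 := by
  have h := cast_cfDen hξ 0
  rw [(dens_zero_one hξ).1] at h
  exact_mod_cast h

theorem cfDen_one {ξ : ℝ} (hξ : Irrational ξ) : (cfDen ξ 1 : ℤ) = cfQuot ξ 1 := by
  have h := cast_cfDen hξ 1
  rw [(dens_zero_one hξ).2] at h
  exact_mod_cast h

theorem cfDen_rec {ξ : ℝ} (hξ : Irrational ξ) (n : ℕ) :
    (cfDen ξ (n + 2) : ℤ) = cfQuot ξ (n + 2) * cfDen ξ (n + 1) + cfDen ξ n := by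
  have h := dens_rec hξ n
  simp only [← cast_cfDen hξ] at h
  exact_mod_cast h

theorem cfDen_pos {ξ : ℝ} (hξ : Irrational ξ) (n : ℕ) : 0 < cfDen ξ n := by
  have key : ∀ n, 0 < cfDen ξ n ∧ 0 < cfDen ξ (n + 1) := by
    intro n
    induction n with
    | zero =>
      have h1 := cfDen_one hξ
      have h2 := cfQuot_pos hξ 0
      simp only [Nat.zero_add] at h2
      exact ⟨by simp [cfDen_zero hξ], by simp only [Nat.zero_add]; omega⟩
    | succ n ih =>
      refine ⟨ih.2, ?_⟩
      have h1 := cfDen_rec hξ n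
      have h2 : 1 ≤ cfQuot ξ (n + 2) := cfQuot_pos hξ (n + 1)
      have h3 : (0 : ℤ) < cfDen ξ n := by exact_mod_cast ih.1
      have h4 : (0 : ℤ) ≤ cfQuot ξ (n + 2) * cfDen ξ (n + 1) := by
        apply mul_nonneg <;> omega
      show 0 < cfDen ξ (n + 2)
      omega
  exact (key n).1

theorem le_cfDen {ξ : ℝ} (hξ : Irrational ξ) (n : ℕ) : n ≤ cfDen ξ n := by
  have key : ∀ n, n ≤ cfDen ξ n ∧ n + 1 ≤ cfDen ξ (n + 1) := by
    intro n
    induction n with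
    | zero => exact ⟨Nat.zero_le _, cfDen_pos hξ 1⟩
    | succ n ih =>
      refine ⟨ih.2, ?_⟩
      have h1 := cfDen_rec hξ n
      have h2 := cfQuot_pos hξ (n + 1)
      have h3 := cfDen_pos hξ n
      have h4 : (1 : ℤ) * cfDen ξ (n + 1) ≤ cfQuot ξ (n + 2) * cfDen ξ (n + 1) :=
        mul_le_mul_of_nonneg_right h2 (by positivity)
      show n + 2 ≤ cfDen ξ (n + 2)
      omega
  exact (key n).1

theorem ostrowski_sum_lt {ξ : ℝ} (hξ : Irrational ξ) {b : ℕ →₀ ℕ} {N : ℕ}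
    (hb : IsOstrowskiRep ξ b N) (m : ℕ) :
    ∑ i ∈ Finset.range m, b i * cfDen ξ i < cfDen ξ m := by
  have key : ∀ m, ∑ i ∈ Finset.range m, b i * cfDen ξ i < cfDen ξ m ∧
      ∑ i ∈ Finset.range (m + 1), b i * cfDen ξ i < cfDen ξ (m + 1) := by
    intro m
    induction m with
    | zero =>
      have h0 := hb.digit_zero
      have h1 := cfDen_one hξ
      refine ⟨by simp [cfDen_zero hξ], ?_⟩
      simp only [Nat.zero_add, Finset.sum_range_one, cfDen_zero hξ, mul_one]
      omega
    | succ m ih =>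
      refine ⟨ih.2, ?_⟩
      rw [Finset.sum_range_succ]
      have hr := cfDen_rec hξ m
      zify
      rw [show m + 1 + 1 = m + 2 from rfl, hr]
      have h2 : (∑ i ∈ Finset.range (m + 1), (b i : ℤ) * cfDen ξ i) < cfDen ξ (m + 1) := by
        exact_mod_cast ih.2
      rcases (hb.digit_le (m + 1) (by omega)).lt_or_eq with h | h
      · have h3 : ((b (m + 1) : ℤ) + 1) * cfDen ξ (m + 1)
            ≤ cfQuot ξ (m + 2) * cfDen ξ (m + 1) :=
          mul_le_mul_of_nonneg_right (by simpa using h) (by positivity)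
        have h5 : (0 : ℤ) ≤ cfDen ξ m := by positivity
        linarith
      · have h3 : b m = 0 := by simpa using hb.digit_eq (m + 1) (by omega) h
        have h4 : (∑ i ∈ Finset.range m, (b i : ℤ) * cfDen ξ i) < cfDen ξ m := by
          exact_mod_cast ih.1
        rw [Finset.sum_range_succ, h3, h]
        push_cast
        linarith
  exact (key m).1

theorem ostrowski_digit {ξ : ℝ} (hξ : Irrational ξ) {b : ℕ →₀ ℕ} {N : ℕ}
    (hb : IsOstrowskiRep ξ b N) (m : ℕ) :
    (∑ i ∈ Finset.range (m + 1), b i * cfDen ξ i) / cfDen ξ m = b m := by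
  rw [Finset.sum_range_succ, Nat.add_mul_div_right _ _ (cfDen_pos hξ m),
    Nat.div_eq_of_lt (ostrowski_sum_lt hξ hb m), zero_add]

theorem ostrowski_sum_range {ξ : ℝ} {b : ℕ →₀ ℕ} {N m : ℕ}
    (hb : IsOstrowskiRep ξ b N) (hm : ∀ i, m ≤ i → b i = 0) :
    N = ∑ i ∈ Finset.range m, b i * cfDen ξ i := by
  rw [hb.sum_eq]
  refine Finsupp.sum_of_support_subset _ (fun i hi => ?_) _ (by simp)
  by_contra h
  exact (Finsupp.mem_support_iff.1 hi) (hm i (by simpa using h))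

theorem ostrowski_unique {ξ : ℝ} (hξ : Irrational ξ) {b c : ℕ →₀ ℕ} {N : ℕ}
    (hb : IsOstrowskiRep ξ b N) (hc : IsOstrowskiRep ξ c N) : b = c := by
  have key : ∀ m, (∑ i ∈ Finset.range m, b i * cfDen ξ i =
      ∑ i ∈ Finset.range m, c i * cfDen ξ i) → ∀ i < m, b i = c i := by
    intro m
    induction m with
    | zero => simp
    | succ m ih =>
      intro h i hi
      have hm : b m = c m := by rw [← ostrowski_digit hξ hb, ← ostrowski_digit hξ hc, h]
      rw [Finset.sum_range_succ, Finset.sum_range_succ, hm] at h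
      rcases Nat.lt_succ_iff_lt_or_eq.1 hi with h' | rfl
      · exact ih (by omega) i h'
      · exact hm
  obtain ⟨M, hM⟩ : ∃ M, ∀ i, M ≤ i → b i = 0 ∧ c i = 0 := by
    refine ⟨(b.support ∪ c.support).sup id + 1, fun i hi => ?_⟩
    by_contra h
    have hmem : i ∈ b.support ∪ c.support := by
      simp only [Finset.mem_union, Finsupp.mem_support_iff]
      tauto
    have := Finset.le_sup (f := id) hmem
    simp only [id] at this
    omega
  ext i
  rcases lt_or_ge i M with h | h
  · refine key M ?_ i h
    rw [← ostrowski_sum_range hb fun i hi => (hM i hi).1,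
      ← ostrowski_sum_range hc fun i hi => (hM i hi).2]
  · rw [(hM i h).1, (hM i h).2]

theorem ostrowski_exists_aux {ξ : ℝ} (hξ : Irrational ξ) (m : ℕ) :
    ∀ N < cfDen ξ m, ∃ b : ℕ →₀ ℕ, IsOstrowskiRep ξ b N ∧ ∀ i, m ≤ i → b i = 0 := by
  induction m with
  | zero =>
    intro N hN
    rw [cfDen_zero hξ] at hN
    obtain rfl : N = 0 := by omega
    have h := cfQuot_pos hξ
    refine ⟨0, ⟨?_, fun i _ => ?_, fun _ _ _ => rfl, by simp⟩, fun _ _ => rfl⟩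
    · have := h 0
      simp only [Finsupp.coe_zero, Pi.zero_apply, Nat.zero_add] at *
      omega
    · have := h i
      simp only [Finsupp.coe_zero, Pi.zero_apply]
      omega
  | succ m ih =>
    intro N hN
    have hq := cfDen_pos hξ m
    obtain ⟨b, hb, hbm⟩ := ih (N % cfDen ξ m) (Nat.mod_lt _ hq)
    have hdiv := Nat.div_add_mod N (cfDen ξ m)
    set d := N / cfDen ξ m with hd
    set r := N % cfDen ξ m with hr
    have hne : ∀ i, i ≠ m → b.update m d i = b i := fun i hi => by simp [hi]
    have heq : b.update m d m = d := by simp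
    refine ⟨b.update m d, ⟨?_, fun i hi => ?_, fun i hi h => ?_, ?_⟩, fun i hi => ?_⟩
    · rcases Nat.eq_zero_or_pos m with rfl | hm
      · have h1 := cfDen_one hξ
        rw [cfDen_zero hξ] at hd
        rw [heq, ← h1, hd]
        simpa using hN
      · rw [hne 0 (by omega)]
        exact hb.digit_zero
    · by_cases him : i = m
      · subst him
        rw [heq]
        obtain ⟨k, rfl⟩ : ∃ k, i = k + 1 := ⟨i - 1, by omega⟩
        have hrec := cfDen_rec hξ k
        by_contra hcon
        push Not at hcon
        have h1 : (cfQuot ξ (k + 2) + 1) * (cfDen ξ (k + 1) : ℤ) ≤ d * cfDen ξ (k + 1) :=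
          mul_le_mul_of_nonneg_right hcon (by positivity)
        have h2 : cfDen ξ k ≤ cfDen ξ (k + 1) := by
          have h3 : (GenContFract.of ξ).dens k ≤ (GenContFract.of ξ).dens (k + 1) :=
            GenContFract.of_den_mono
          rw [← cast_cfDen hξ, ← cast_cfDen hξ] at h3
          exact_mod_cast h3
        zify at hdiv hN h2
        rw [hrec] at hN
        have h4 : (0 : ℤ) ≤ r := by positivity
        linarith
      · rw [hne i him]
        exact hb.digit_le i hi
    · by_cases him : i = m
      · subst him
        rw [heq] at h
        rw [hne _ (by omega)]
        obtain ⟨k, rfl⟩ : ∃ k, i = k + 1 := ⟨i - 1, by omega⟩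
        have hrec := cfDen_rec hξ k
        have hrk : r < cfDen ξ k := by
          zify at hdiv hN ⊢
          rw [hrec] at hN
          rw [h] at hdiv
          linarith
        have h5 := ostrowski_digit hξ hb k
        rw [← ostrowski_sum_range hb hbm, Nat.div_eq_of_lt hrk] at h5
        simpa using h5.symm
      · rw [hne i him] at h
        by_cases him' : i - 1 = m
        · exfalso
          rw [hbm i (by omega)] at h
          have := cfQuot_pos hξ i
          push_cast at h
          omega
        · rw [hne _ him']
          exact hb.digit_eq i hi h
    · have hsum : (b.update m d).sum (fun i d => d * cfDen ξ i) =
          ∑ i ∈ Finset.range (m + 1), b.update m d i * cfDen ξ i := by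
        refine Finsupp.sum_of_support_subset _ (fun i hi => ?_) _ (by simp)
        by_contra h
        have him : m + 1 ≤ i := by simpa using h
        refine (Finsupp.mem_support_iff.1 hi) ?_
        rw [hne i (by omega), hbm i (by omega)]
      rw [hsum, Finset.sum_range_succ, heq, Finset.sum_congr rfl
        (g := fun i => b i * cfDen ξ i) fun i hi => by
          rw [hne i (by have := Finset.mem_range.1 hi; omega)],
        ← ostrowski_sum_range hb hbm]
      rw [← hdiv]
      ring
    · rw [hne i (by omega), hbm i (by omega)]

theorem ostrowski_existsUnique {ξ : ℝ} (hξ : Irrational ξ) (N : ℕ) :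
    ∃! b : ℕ →₀ ℕ, IsOstrowskiRep ξ b N := by
  obtain ⟨b, hb, -⟩ := ostrowski_exists_aux hξ (N + 1) N
    (lt_of_lt_of_le (Nat.lt_succ_self N) (le_cfDen hξ (N + 1)))
  exact ⟨b, hb, fun c hc => ostrowski_unique hξ hc hb⟩

end Existence

/-! Write `η = completeQuot ξ` and `ζ = completeQuot η`. If `a_1 = 2h`, then `η = 2h + α` with `α =
1/ζ`. A step of the walk for `2ξ` is `+1` or `-1` according to whether `{jξ}` lies below `1/2` or
not. So the walk rises while `j` is in `[kη, (k+1/2)η)` and falls while `j` is in `[(k+1/2)η,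
(k+1)η)`. Because `a_1` is even, the integer part `2h` of a block contributes equally to both
halves. The net change over a block comes only from `α`, and it is exactly a step of the walk for
`2ζ` (`detWalk_renormalize`).

For a BR-number all partial quotients of odd index are even, so this can be iterated. By induction
the walk is nonnegative, and its positive zeros lie at block ends `N = ⌊Kη⌋ = a_1 K + M`, where `M =
⌊Kα⌋` is a zero for `2ζ` (`detWalk_nonneg_and_zero`).

For a given `M`, the admissible `K` form a run of `a_2 + 1` integers. The offset within this run is
the digit of `q_1`, and the digits of `M` for `ζ` move up two places. Hence the zeros are the sums
of `c_i q_{2i+1}` with `0 ≤ c_i ≤ a_{2i+2}` (`oddValue_bounds_and_zero`, `exists_oddValue_of_zero`).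
Such sums are Ostrowski representations, so uniqueness yields `detWalk_eq_zero_iff`, and a parity
automaton tests the condition on the digits. -/

/-! ### Shifting the continued fraction; parity of the partial quotients -/

/-- The Gauss map, with values in the complete quotients. -/
noncomputable def completeQuot (ξ : ℝ) : ℝ := (Int.fract ξ)⁻¹

theorem irrational_fract {ξ : ℝ} (hξ : Irrational ξ) : Irrational (Int.fract ξ) := by
  rw [← Int.self_sub_floor]
  exact hξ.sub_intCast _

theorem irrational_completeQuot {ξ : ℝ} (hξ : Irrational ξ) : Irrational (completeQuot ξ) :=
  (irrational_fract hξ).inv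

theorem cfQuot_zero (ξ : ℝ) : cfQuot ξ 0 = ⌊ξ⌋ := by
  simp [cfQuot, GenContFract.IntFractPair.stream_zero, GenContFract.IntFractPair.of]

theorem cfQuot_succ {ξ : ℝ} (hξ : Irrational ξ) (i : ℕ) :
    cfQuot ξ (i + 1) = cfQuot (completeQuot ξ) i := by
  rw [cfQuot, GenContFract.IntFractPair.stream_succ (irrational_fract hξ).ne_zero]
  rfl

/-- The continuant recurrence at the left end, as opposed to `cfDen_rec` at the right end. It lets
digit sums for `ξ` be peeled off from the least significant digit. -/
theorem cfDen_add_two {ξ : ℝ} (hξ : Irrational ξ) (i : ℕ) :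
    (cfDen ξ (i + 2) : ℤ) = cfQuot ξ 1 * cfDen (completeQuot ξ) (i + 1) +
      cfDen (completeQuot (completeQuot ξ)) i := by
  have hη := irrational_completeQuot hξ
  have hζ := irrational_completeQuot hη
  have h1 := cfQuot_succ hξ
  have h2 := cfQuot_succ hη
  induction i using Nat.twoStepInduction with
  | zero =>
    have e1 := cfDen_rec hξ 0
    have e2 := cfDen_one hξ
    have e3 := cfDen_one hη
    have e4 := cfDen_zero hξ
    have e5 := cfDen_zero hζ
    have e6 := h1 1
    simp only [Nat.zero_add] at *
    rw [e1, e2, e3, e4, e5, e6]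
    ring
  | one =>
    have e1 := cfDen_rec hξ 1
    have e0 := cfDen_rec hξ 0
    have e2 := cfDen_one hξ
    have e3 := cfDen_one hη
    have e3' := cfDen_one hζ
    have e4 := cfDen_zero hξ
    have e5 := cfDen_zero hη
    have e7 := cfDen_rec hη 0
    have e6 := h1 1
    have e8 := h1 2
    have e9 := h2 1
    simp only [Nat.zero_add, Nat.reduceAdd] at *
    rw [e1, e7, e0, e2, e3, e3', e4, e5, e6, e8, e9]
    push_cast
    ring
  | more n ih1 ih2 =>
    rw [cfDen_rec hξ (n + 2), ih1, ih2, cfDen_rec hη (n + 1), cfDen_rec hζ n,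
      h1 (n + 3), h2 (n + 2)]
    ring

/-- Since the denominators of odd index are even and `q_0 = 1`, the recurrence modulo 2 keeps those
of even index odd. Then `q_{2n+1} = a_{2n+1} q_{2n} + q_{2n-1}` forces `a_{2n+1}` to be even. -/
theorem even_cfQuot_of_isBRNumber {ξ : ℝ} (hξ : Irrational ξ) (hBR : IsBRNumber ξ) (n : ℕ) :
    Even (cfQuot ξ (2 * n + 1)) := by
  have hodd : ∀ n, ¬ Even (cfDen ξ (2 * n) : ℤ) := by
    intro n
    induction n with
    | zero => simp [cfDen_zero hξ]
    | succ n ih =>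
      have h : Even (cfDen ξ (2 * n + 1) : ℤ) := by exact_mod_cast hBR n
      rw [show 2 * (n + 1) = 2 * n + 2 by ring, cfDen_rec hξ, Int.even_add]
      simp [h, ih]
  rcases n with _ | n
  · have h : Even (cfDen ξ 1 : ℤ) := by exact_mod_cast hBR 0
    rwa [cfDen_one hξ] at h
  · have h : Even (cfDen ξ (2 * (n + 1) + 1) : ℤ) := by exact_mod_cast hBR (n + 1)
    have h' : Even (cfDen ξ (2 * n + 1) : ℤ) := by exact_mod_cast hBR n
    have ho := hodd (n + 1)
    rw [show 2 * (n + 1) + 1 = (2 * n + 1) + 2 by ring, cfDen_rec hξ, Int.even_add,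
      Int.even_mul] at h
    rw [show 2 * (n + 1) + 1 = (2 * n + 1) + 2 by ring]
    rw [show 2 * (n + 1) = 2 * n + 1 + 1 by ring] at ho
    tauto

/-! ### Signs of single steps -/

theorem negOnePow_floor_of_lt_half {t : ℝ} {n : ℤ} (h1 : n ≤ t) (h2 : t < n + 1 / 2) :
    (⌊2 * t⌋.negOnePow : ℤ) = 1 := by
  have h : ⌊2 * t⌋ = 2 * n := by
    rw [Int.floor_eq_iff]
    push_cast
    constructor <;> linarith
  rw [h, Int.negOnePow_two_mul]
  rfl

theorem negOnePow_floor_of_half_le {t : ℝ} {n : ℤ} (h1 : n + 1 / 2 ≤ t) (h2 : t < n + 1) :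
    (⌊2 * t⌋.negOnePow : ℤ) = -1 := by
  have h : ⌊2 * t⌋ = 2 * n + 1 := by
    rw [Int.floor_eq_iff]
    push_cast
    constructor <;> linarith
  rw [h, Int.negOnePow_two_mul_add_one]
  rfl

theorem detWalk_zero (ξ : ℝ) : detWalk ξ 0 = 0 := by simp [detWalk]

theorem detWalk_succ (ξ : ℝ) (n : ℕ) :
    detWalk ξ (n + 1) = detWalk ξ n + (⌊((n + 1 : ℕ) : ℝ) * ξ⌋.negOnePow : ℤ) := by
  rw [detWalk, Finset.sum_Icc_succ_top (by omega)]
  rfl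

theorem detWalk_succ_of_lt_half {ξ : ℝ} {m : ℕ} {n : ℤ} (h1 : n ≤ (m + 1) * ξ)
    (h2 : (m + 1) * ξ < n + 1 / 2) : detWalk (2 * ξ) (m + 1) = detWalk (2 * ξ) m + 1 := by
  rw [detWalk_succ, ← negOnePow_floor_of_lt_half h1 h2]
  push_cast
  rw [show ((m : ℝ) + 1) * (2 * ξ) = 2 * ((m + 1) * ξ) by ring]

theorem detWalk_succ_of_half_le {ξ : ℝ} {m : ℕ} {n : ℤ} (h1 : n + 1 / 2 ≤ (m + 1) * ξ)
    (h2 : (m + 1) * ξ < n + 1) : detWalk (2 * ξ) (m + 1) = detWalk (2 * ξ) m - 1 := by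
  rw [detWalk_succ, sub_eq_add_neg, ← negOnePow_floor_of_half_le h1 h2]
  push_cast
  rw [show ((m : ℝ) + 1) * (2 * ξ) = 2 * ((m + 1) * ξ) by ring]

/-! ### Renormalization of the walk over blocks of length `2h + α` -/

section Renormalization

variable {ξ ζ α : ℝ} {h : ℕ}

/-- The walk for `ξ` in terms of the walk for `ζ`, where `(fract ξ)⁻¹ = 2h + α` and `α⁻¹ = ζ`. -/
theorem detWalk_renormalize (hh : 1 ≤ h) (hα : Irrational α) (hα0 : 0 < α) (hα1 : α < 1)
    (hx : Int.fract ξ * (2 * h + α) = 1) (hζ : ζ * α = 1) (N k : ℕ) :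
    (k * (2 * h + α) ≤ N → (N : ℝ) < (k + 1 / 2) * (2 * h + α) →
      detWalk (2 * ξ) N =
        detWalk (2 * ζ) ⌊k * α⌋₊ + N - (2 * h * k + ⌊k * α⌋₊ : ℕ)) ∧
    ((k + 1 / 2) * (2 * h + α) ≤ N → (N : ℝ) < (k + 1) * (2 * h + α) →
      detWalk (2 * ξ) N = detWalk (2 * ζ) ⌊(k + 1) * α⌋₊ +
        (2 * h * (k + 1) + ⌊(k + 1) * α⌋₊ : ℕ) - N) := by
  have hhR : (1 : ℝ) ≤ h := by exact_mod_cast hh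
  have hη : 0 < 2 * h + α := by positivity
  have hx0 : 0 < Int.fract ξ := pos_of_mul_pos_left (hx ▸ one_pos) hη.le
  have hζ0 : 0 < ζ := pos_of_mul_pos_left (hζ ▸ one_pos) hα0.le
  have hirr : ∀ (k : ℕ) (z : ℤ), k ≠ 0 → (k : ℝ) * α ≠ z := fun k z hk =>
    (hα.natCast_mul hk).ne_int z
  -- Multiplication by `fract ξ` turns bounds on a time `j` by multiples of `2h + α` into bounds on
  -- `j * fract ξ` by integers and half-integers.
  have toξ : ∀ (t : ℝ) (j : ℕ), j * ξ = j * Int.fract ξ + j * ⌊ξ⌋ ∧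
      t = (t * (2 * h + α)) * Int.fract ξ := fun t j => by
    constructor
    · rw [← mul_add, Int.fract_add_floor]
    · linear_combination -t * hx
  induction N generalizing k with
  | zero =>
    constructor
    · intro h1 _
      obtain rfl : k = 0 := by
        by_contra hk
        have : (0 : ℝ) < k := by positivity
        have := mul_pos this hη
        push_cast at h1
        linarith
      simp [detWalk_zero]
    · intro h1 _
      have : (0 : ℝ) < (k + 1 / 2) * (2 * h + α) := by positivity
      push_cast at h1
      linarith
  | succ N ih =>
    push_cast
    constructor
    · intro h1 h2
      have hs : detWalk (2 * ξ) (N + 1) = detWalk (2 * ξ) N + 1 := by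
        have e1 := mul_le_mul_of_nonneg_right h1 hx0.le
        have e2 := mul_lt_mul_of_pos_right h2 hx0
        rw [← (toξ _ 0).2] at e1 e2
        have e3 := (toξ 0 (N + 1)).1
        push_cast at e3
        apply detWalk_succ_of_lt_half (n := k + (N + 1) * ⌊ξ⌋) <;> push_cast <;> linarith
      rw [hs]
      rcases le_or_gt (k * (2 * h + α)) (N : ℝ) with hN | hN
      · rw [(ih k).1 hN (by linarith)]
        push_cast
        ring
      -- Time `N` is the last one of the previous block, so `N` is the floor of the block boundary.
      -- The falling formula of that block applies, and its excess over the renormalized walk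
      -- vanishes.
      · obtain _ | k := k
        · exfalso
          push_cast at hN
          have : (0 : ℝ) ≤ N := by positivity
          linarith
        push_cast at *
        have hne := hirr (k + 1) (N + 1 - 2 * h * (k + 1)) (by omega)
        push_cast at hne
        have hf : ⌊((k : ℝ) + 1) * α⌋ = (N : ℤ) - 2 * h * (k + 1) := by
          rw [Int.floor_eq_iff]
          push_cast
          have : ((k : ℝ) + 1) * α < N + 1 - 2 * h * (k + 1) :=
            lt_of_le_of_ne (by linarith) hne
          constructor <;> linarith
        rw [(ih k).2 (by linarith) (by linarith)]
        have hc : ((⌊((k : ℝ) + 1) * α⌋₊ : ℕ) : ℤ) = ⌊((k : ℝ) + 1) * α⌋ :=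
          Int.natCast_floor_eq_floor (by positivity)
        rw [hc, hf]
        ring
    · intro h1 h2
      have hs : detWalk (2 * ξ) (N + 1) = detWalk (2 * ξ) N - 1 := by
        have e1 := mul_le_mul_of_nonneg_right h1 hx0.le
        have e2 := mul_lt_mul_of_pos_right h2 hx0
        rw [← (toξ _ 0).2] at e1 e2
        have e3 := (toξ 0 (N + 1)).1
        push_cast at e3
        apply detWalk_succ_of_half_le (n := k + (N + 1) * ⌊ξ⌋) <;> push_cast <;> linarith
      rw [hs]
      rcases le_or_gt ((k + 1 / 2) * (2 * h + α)) (N : ℝ) with hN | hN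
      · rw [(ih k).2 hN (by linarith)]
        push_cast
        ring
      · rw [(ih k).1 (by linarith) hN]
        have hm0 := Nat.floor_le (show 0 ≤ (k : ℝ) * α by positivity)
        have hm1 := Nat.lt_floor_add_one ((k : ℝ) * α)
        set m := ⌊(k : ℝ) * α⌋₊ with hm
        -- Here the walk passes its peak: `N < (k + 1/2)(2h + α) ≤ N + 1`. Hence `t` is the floor of
        -- `(k + 1/2)α`, and only its position relative to `m` matters.
        obtain ⟨t, ht⟩ : ∃ t : ℤ, t = N - 2 * h * k - h := ⟨_, rfl⟩
        have htR : (t : ℝ) = N - 2 * h * k - h := by rw [ht]; push_cast; ring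
        rcases lt_or_ge (((k : ℝ) + 1) * α) (m + 1) with hlt | hge
        · have hf : ⌊((k : ℝ) + 1) * α⌋₊ = m := by
            rw [Nat.floor_eq_iff (by positivity)]
            constructor <;> linarith
          have htm : t = m := by
            have e1 : t < m + 1 := by
              have : (t : ℝ) < m + 1 := by linarith
              exact_mod_cast this
            have e2 : (m : ℤ) < t + 1 := by
              have : (m : ℝ) < t + 1 := by linarith
              exact_mod_cast this
            omega
          rw [hf]
          push_cast
          linear_combination 2 * htm - 2 * ht
        · have hf : ⌊((k : ℝ) + 1) * α⌋₊ = m + 1 := by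
            rw [Nat.floor_eq_iff (by positivity)]
            push_cast
            constructor <;> linarith
          have toζ : ∀ s : ℝ, s = (s * α) * ζ := fun s => by linear_combination -s * hζ
          have hne := hirr (2 * k + 1) (2 * (m + 1)) (by omega)
          push_cast at hne
          rw [hf]
          -- The floor of `kα` jumps within this block. Multiplied by `ζ`, the comparison decides
          -- whether `(m + 1)ζ` lies in the lower or upper half of `[k, k + 1)`, which is the sign
          -- of the step for `2ζ`.
          rcases lt_or_ge ((m : ℝ) + 1) ((k + 1 / 2) * α) with hl | hl
          · have hw : detWalk (2 * ζ) (m + 1) = detWalk (2 * ζ) m + 1 := by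
              have e1 := mul_lt_mul_of_pos_right hm1 hζ0
              have e2 := mul_lt_mul_of_pos_right hl hζ0
              rw [← toζ] at e1 e2
              apply detWalk_succ_of_lt_half (n := k) <;> push_cast <;> linarith
            have htm : t = m + 1 := by
              have e1 : t < m + 2 := by
                have : (t : ℝ) < m + 2 := by linarith
                exact_mod_cast this
              have e2 : (m : ℤ) + 1 < t + 1 := by
                have : (m : ℝ) + 1 < t + 1 := by linarith
                exact_mod_cast this
              omega
            rw [hw]
            push_cast
            linear_combination 2 * htm - 2 * ht
          · have hl' : (k + 1 / 2) * α < (m : ℝ) + 1 :=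
              lt_of_le_of_ne hl fun h => hne (by linarith)
            have hne' := hirr (k + 1) (m + 1) (by omega)
            push_cast at hne'
            have hge' := lt_of_le_of_ne hge hne'.symm
            have hw : detWalk (2 * ζ) (m + 1) = detWalk (2 * ζ) m - 1 := by
              have e1 := mul_lt_mul_of_pos_right hl' hζ0
              have e2 := mul_lt_mul_of_pos_right hge' hζ0
              rw [← toζ] at e1 e2
              apply detWalk_succ_of_half_le (n := k) <;> push_cast <;> linarith
            have htm : t = m := by
              have e1 : t < m + 1 := by
                have : (t : ℝ) < m + 1 := by linarith
                exact_mod_cast this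
              have e2 : (m : ℤ) < t + 1 := by
                have : (m : ℝ) < t + 1 := by linarith
                exact_mod_cast this
              omega
            rw [hw]
            push_cast
            linear_combination 2 * htm - 2 * ht

end Renormalization

/-! ### Nonnegativity and descent of zeros -/

/-- The data of two steps of the continued fraction algorithm at an even partial quotient. -/
theorem exists_renormalization {ξ : ℝ} (hξ : Irrational ξ) (he : Even (cfQuot ξ 1)) :
    ∃ (h : ℕ) (α : ℝ), 1 ≤ h ∧ Irrational α ∧ 0 < α ∧ α < 1 ∧ cfQuot ξ 1 = 2 * h ∧
      Int.fract ξ * (2 * h + α) = 1 ∧ completeQuot (completeQuot ξ) * α = 1 := by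
  have hη := irrational_completeQuot hξ
  have hα := irrational_fract hη
  obtain ⟨r, hr⟩ := he
  have hpos := cfQuot_pos hξ 0
  simp only [Nat.zero_add] at hpos
  lift r to ℕ using by omega
  have hq : cfQuot ξ 1 = ⌊completeQuot ξ⌋ := by
    rw [← cfQuot_zero, ← cfQuot_succ hξ]
  have hsum : completeQuot ξ = 2 * r + Int.fract (completeQuot ξ) := by
    have h1 := Int.floor_add_fract (completeQuot ξ)
    rw [← hq, hr] at h1
    push_cast at h1
    linarith
  refine ⟨r, Int.fract (completeQuot ξ), by omega, hα,
    lt_of_le_of_ne (Int.fract_nonneg _) hα.ne_zero.symm, Int.fract_lt_one _, by omega, ?_,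
    inv_mul_cancel₀ hα.ne_zero⟩
  rw [← hsum]
  exact mul_inv_cancel₀ (irrational_fract hξ).ne_zero

/-- All partial quotients of odd index are even. -/
def HasEvenOddQuots (ξ : ℝ) : Prop := ∀ n : ℕ, Even (cfQuot ξ (2 * n + 1))

theorem HasEvenOddQuots.shift {ξ : ℝ} (hξ : Irrational ξ) (h : HasEvenOddQuots ξ) :
    HasEvenOddQuots (completeQuot (completeQuot ξ)) := fun n => by
  rw [← cfQuot_succ (irrational_completeQuot hξ), ← cfQuot_succ hξ]
  exact h (n + 1)

/-- The bounds say that `M = ⌊Kα⌋`, so `N = ⌊K(2h + α)⌋` is a block boundary, where the two walks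
agree. -/
theorem detWalk_floor_mul {ξ : ℝ} (hξ : Irrational ξ) (he : Even (cfQuot ξ 1)) {K M : ℕ}
    (h1 : M * completeQuot (completeQuot ξ) ≤ K)
    (h2 : K < (M + 1) * completeQuot (completeQuot ξ)) {N : ℕ}
    (hN : (N : ℤ) = cfQuot ξ 1 * K + M) :
    detWalk (2 * ξ) N = detWalk (2 * completeQuot (completeQuot ξ)) M := by
  obtain ⟨h, α, hh, hα, hα0, hα1, hq, hx, hζ⟩ := exists_renormalization hξ he
  have e1 := mul_le_mul_of_nonneg_right h1 hα0.le
  have e2 := mul_lt_mul_of_pos_right h2 hα0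
  rw [mul_assoc, hζ, mul_one] at e1 e2
  have hhR : (1 : ℝ) ≤ h := by exact_mod_cast hh
  rw [hq] at hN
  have hNR : (N : ℝ) = 2 * h * K + M := by exact_mod_cast hN
  rcases K with _ | K
  · obtain rfl : M = 0 := by
      have : (M : ℝ) ≤ 0 := by simpa using e1
      exact_mod_cast this.antisymm (by positivity)
    obtain rfl : N = 0 := by simpa using hN
    simp [detWalk_zero]
  · have hf : ⌊((K : ℝ) + 1) * α⌋₊ = M := by
      rw [Nat.floor_eq_iff (by positivity)]
      push_cast at e1 e2
      exact ⟨e1, e2⟩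
    push_cast at e1 e2 hNR
    have hne := (hα.natCast_mul (Nat.succ_ne_zero K)).ne_nat M
    push_cast at hne
    have e1' := lt_of_le_of_ne e1 hne.symm
    -- For positive index the boundary is the last time in the falling half of the preceding block;
    -- irrationality makes the upper bound strict.
    rw [(detWalk_renormalize hh hα hα0 hα1 hx hζ N K).2 (by linarith) (by linarith), hf]
    push_cast at hN ⊢
    linarith

/-- The walk does not become negative, and its zeros come from zeros of the renormalized walk. -/
theorem detWalk_nonneg_and_zero {ξ : ℝ} (hξ : Irrational ξ) (hev : HasEvenOddQuots ξ) (N : ℕ) :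
    0 ≤ detWalk (2 * ξ) N ∧ (detWalk (2 * ξ) N = 0 → ∃ K M : ℕ,
      M * completeQuot (completeQuot ξ) ≤ K ∧ K < (M + 1) * completeQuot (completeQuot ξ) ∧
      (N : ℤ) = cfQuot ξ 1 * K + M ∧ detWalk (2 * completeQuot (completeQuot ξ)) M = 0) := by
  induction N using Nat.strong_induction_on generalizing ξ with
  | _ N ih =>
  have hζirr := irrational_completeQuot (irrational_completeQuot hξ)
  have hevζ := hev.shift hξ
  obtain ⟨h, α, hh, hα, hα0, hα1, hq, hx, hζ⟩ := exists_renormalization hξ (hev 0)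
  set ζ := completeQuot (completeQuot ξ)
  have hhR : (1 : ℝ) ≤ h := by exact_mod_cast hh
  have hζ0 : 0 < ζ := pos_of_mul_pos_left (hζ ▸ one_pos) hα0.le
  rcases Nat.eq_zero_or_pos N with rfl | hNpos
  · refine ⟨by simp [detWalk_zero], fun _ => ⟨0, 0, ?_, ?_, ?_, ?_⟩⟩
    · simp
    · simpa using hζ0
    · simp
    · simp [detWalk_zero]
  have hη : 0 < 2 * h + α := by positivity
  have hk0 := Nat.floor_le (show 0 ≤ (N : ℝ) / (2 * h + α) by positivity)
  have hk1 := Nat.lt_floor_add_one ((N : ℝ) / (2 * h + α))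
  -- The index of the block that contains `N`.
  set k := ⌊(N : ℝ) / (2 * h + α)⌋₊
  rw [le_div_iff₀ hη] at hk0
  rw [div_lt_iff₀ hη] at hk1
  have hkα : 0 ≤ (k : ℝ) * α := by positivity
  have hkN : k < N := by
    have hNR : (0 : ℝ) < N := by positivity
    have h3 : (k : ℝ) * 1 ≤ k * h := mul_le_mul_of_nonneg_left hhR (by positivity)
    have : (k : ℝ) < N := by
      rcases Nat.eq_zero_or_pos k with hk | hk
      · rw [hk]; simpa using hNR
      · have : (0 : ℝ) < k := by positivity
        linarith
    exact_mod_cast this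
  obtain ⟨hlow, hhigh⟩ := detWalk_renormalize hh hα hα0 hα1 hx hζ N k
  rcases lt_or_ge (N : ℝ) ((k + 1 / 2) * (2 * h + α)) with hN | hN
  · have hm := Nat.floor_le hkα
    have hw := hlow hk0 hN
    -- In the rising half the excess over the renormalized walk is strictly positive, so no zero
    -- occurs there. The block starting at `0` needs `N > 0`; elsewhere irrationality of `α` gives
    -- strictness.
    have hlt : 2 * h * k + ⌊(k : ℝ) * α⌋₊ < N := by
      rcases Nat.eq_zero_or_pos k with hk | hk
      · simpa [hk] using hNpos
      · have hne := (hα.natCast_mul hk.ne').ne_nat ⌊(k : ℝ) * α⌋₊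
        have hm' := lt_of_le_of_ne hm hne.symm
        have : ((2 * h * k + ⌊(k : ℝ) * α⌋₊ : ℕ) : ℝ) < N := by
          push_cast
          linarith
        exact_mod_cast this
    have hpos := (ih _ (lt_of_le_of_lt (Nat.le_add_left _ _) hlt) hζirr hevζ).1
    have : (0 : ℤ) < detWalk (2 * ξ) N := by
      rw [hw]
      zify at hlt
      push_cast at hlt ⊢
      linarith
    exact ⟨this.le, fun h => absurd h this.ne'⟩
  · have hkα' : 0 ≤ ((k : ℝ) + 1) * α := by positivity
    have hm := Nat.floor_le hkα'
    have hm1 := Nat.lt_floor_add_one (((k : ℝ) + 1) * α)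
    have hw := hhigh hN hk1
    set M := ⌊((k : ℝ) + 1) * α⌋₊
    have hle : N ≤ 2 * h * (k + 1) + M := by
      have : (N : ℝ) < (2 * h * (k + 1) + M : ℕ) + 1 := by
        push_cast
        linarith
      exact Nat.lt_succ_iff.1 (by exact_mod_cast this)
    have hMN : M < N := by
      have : (M : ℝ) < k + 1 := by
        have : ((k : ℝ) + 1) * α < (k + 1) * 1 := mul_lt_mul_of_pos_left hα1 (by positivity)
        linarith
      have : M < k + 1 := by exact_mod_cast this
      omega
    have hpos := (ih M hMN hζirr hevζ).1
    rw [hw]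
    zify at hle
    push_cast at hle ⊢
    -- In the falling half the walk is a sum of two nonnegative terms. A zero kills both, which puts
    -- `N` at the block end and makes `M` a zero.
    refine ⟨by linarith, fun h0 => ⟨k + 1, M, ?_, ?_, ?_, by linarith⟩⟩
    · have e := mul_le_mul_of_nonneg_right hm hζ0.le
      rw [mul_assoc, mul_comm α, hζ] at e
      push_cast
      linarith
    · have e := mul_lt_mul_of_pos_right hm1 hζ0
      rw [mul_assoc, mul_comm α, hζ] at e
      push_cast
      linarith
    · rw [hq]
      push_cast
      linarith

/-! ### Digit expansions of the zeros -/

/-- The value of a sequence of digits standing in the odd positions. -/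
noncomputable def oddValue (ξ : ℝ) (c : ℕ → ℕ) (L : ℕ) : ℕ :=
  ∑ i ∈ Finset.range L, c i * cfDen ξ (2 * i + 1)

/-- The value of a sequence of digits standing in the even positions. -/
noncomputable def evenValue (ξ : ℝ) (c : ℕ → ℕ) (L : ℕ) : ℕ :=
  ∑ i ∈ Finset.range L, c i * cfDen ξ (2 * i)

theorem evenValue_succ {ξ : ℝ} (hξ : Irrational ξ) (c : ℕ → ℕ) (L : ℕ) :
    (evenValue ξ c (L + 1) : ℤ) = c 0 +
      cfQuot ξ 1 * oddValue (completeQuot ξ) (fun i => c (i + 1)) L +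
      evenValue (completeQuot (completeQuot ξ)) (fun i => c (i + 1)) L := by
  simp only [evenValue, oddValue]
  rw [Finset.sum_range_succ']
  push_cast
  rw [Finset.mul_sum, cfDen_zero hξ, add_assoc (c 0 : ℤ), ← Finset.sum_add_distrib,
    add_comm]
  congr 1
  · push_cast; ring
  · refine Finset.sum_congr rfl fun i _ => ?_
    rw [mul_add, mul_one, cfDen_add_two hξ]
    ring

theorem oddValue_succ {ξ : ℝ} (hξ : Irrational ξ) (c : ℕ → ℕ) (L : ℕ) :
    (oddValue ξ c (L + 1) : ℤ) = cfQuot ξ 1 * evenValue (completeQuot ξ) c (L + 1) +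
      oddValue (completeQuot (completeQuot ξ)) (fun i => c (i + 1)) L := by
  simp only [evenValue, oddValue]
  rw [Finset.sum_range_succ', Finset.sum_range_succ']
  push_cast
  rw [mul_add, Finset.mul_sum, cfDen_one hξ,
    cfDen_zero (irrational_completeQuot hξ), add_right_comm, ← Finset.sum_add_distrib]
  congr 1
  · refine Finset.sum_congr rfl fun i _ => ?_
    rw [show 2 * (i + 1) + 1 = 2 * i + 1 + 2 by ring, show 2 * (i + 1) = 2 * i + 1 + 1 by ring,
      cfDen_add_two hξ]
    ring
  · push_cast; ring

theorem shift_digit_le {ξ : ℝ} (hξ : Irrational ξ) {c : ℕ → ℕ}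
    (hc : ∀ i, (c i : ℤ) ≤ cfQuot ξ (2 * i + 2)) (i : ℕ) :
    (c (i + 1) : ℤ) ≤ cfQuot (completeQuot (completeQuot ξ)) (2 * i + 2) := by
  rw [← cfQuot_succ (irrational_completeQuot hξ), ← cfQuot_succ hξ]
  exact hc (i + 1)

theorem completeQuot_pos {ξ : ℝ} (hξ : Irrational ξ) : 0 < completeQuot ξ :=
  inv_pos.2 (lt_of_le_of_ne (Int.fract_nonneg _) (irrational_fract hξ).ne_zero.symm)

theorem cfQuot_two_add_fract {ξ : ℝ} (hξ : Irrational ξ) :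
    completeQuot (completeQuot ξ) =
      cfQuot ξ 2 + Int.fract (completeQuot (completeQuot ξ)) := by
  rw [cfQuot_succ hξ, cfQuot_succ (irrational_completeQuot hξ), cfQuot_zero,
    Int.floor_add_fract]

/-- Splitting `ζ = a_2 + fract ζ`, the lower bound holds already for `d = 0` and the upper bound
still holds for `d = a_2`. -/
theorem bounds_of_digit {ξ : ℝ} (hξ : Irrational ξ) {d K K' M : ℕ} (hd : (d : ℤ) ≤ cfQuot ξ 2)
    (hK : (K : ℤ) = d + cfQuot ξ 2 * M + K')
    (h1 : M * Int.fract (completeQuot (completeQuot ξ)) ≤ K')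
    (h2 : K' < (M + 1) * Int.fract (completeQuot (completeQuot ξ))) :
    M * completeQuot (completeQuot ξ) ≤ K ∧ K < (M + 1) * completeQuot (completeQuot ξ) := by
  have hKR : (K : ℝ) = d + cfQuot ξ 2 * M + K' := by exact_mod_cast hK
  have hdR : (d : ℝ) ≤ cfQuot ξ 2 := by exact_mod_cast hd
  have hd0 : (0 : ℝ) ≤ d := by positivity
  rw [cfQuot_two_add_fract hξ, hKR]
  constructor <;> linarith

/-- The bounds make `N = oddValue ξ c L` the floor of `Kη`, where `K` has the same digits `c` in the
even positions for `η`. They are carried through the induction because the passage from `ζ` to `ξ`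
needs them in order to place `N` at a block boundary. -/
theorem oddValue_bounds_and_zero {ξ : ℝ} (hξ : Irrational ξ) (hev : HasEvenOddQuots ξ)
    {c : ℕ → ℕ} (hc : ∀ i, (c i : ℤ) ≤ cfQuot ξ (2 * i + 2)) (L : ℕ) :
    oddValue ξ c L * Int.fract ξ ≤ evenValue (completeQuot ξ) c L ∧
    evenValue (completeQuot ξ) c L < (oddValue ξ c L + 1) * Int.fract ξ ∧
    detWalk (2 * ξ) (oddValue ξ c L) = 0 := by
  induction L generalizing ξ c with
  | zero =>
    refine ⟨by simp [oddValue, evenValue], ?_, by simp [oddValue, detWalk_zero]⟩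
    simpa [oddValue, evenValue] using inv_pos.1 (completeQuot_pos hξ)
  | succ L ih =>
    have hη := irrational_completeQuot hξ
    have hζ := irrational_completeQuot hη
    obtain ⟨i1, i2, i3⟩ := ih hζ (hev.shift hξ) (shift_digit_le hξ hc)
    have hN := oddValue_succ hξ c L
    have hK := evenValue_succ hη c L
    rw [← cfQuot_succ hξ] at hK
    obtain ⟨b1, b2⟩ := bounds_of_digit hξ (hc 0) hK i1 i2
    set N := oddValue ξ c (L + 1)
    set K := evenValue (completeQuot ξ) c (L + 1)
    set M := oddValue (completeQuot (completeQuot ξ)) (fun i => c (i + 1)) L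
    obtain ⟨h, α, hh, -, hα0, -, hq, hx, hζα⟩ := exists_renormalization hξ (hev 0)
    have hx0 : 0 < Int.fract ξ := inv_pos.1 (completeQuot_pos hξ)
    have e1 := mul_le_mul_of_nonneg_right b1 hα0.le
    have e2 := mul_lt_mul_of_pos_right b2 hα0
    rw [mul_assoc, hζα, mul_one] at e1 e2
    have hNR : (N : ℝ) = 2 * h * K + M := by
      rw [hq] at hN
      exact_mod_cast hN
    have hKx : (K : ℝ) = K * (2 * h + α) * Int.fract ξ := by linear_combination -K * hx
    refine ⟨?_, ?_, (detWalk_floor_mul hξ (hev 0) b1 b2 hN).trans i3⟩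
    · rw [hKx]
      exact mul_le_mul_of_nonneg_right (by linarith) hx0.le
    · rw [hKx]
      exact mul_lt_mul_of_pos_right (by linarith) hx0

theorem exists_oddValue_of_zero {ξ : ℝ} (hξ : Irrational ξ) (hev : HasEvenOddQuots ξ) {N : ℕ}
    (hN : detWalk (2 * ξ) N = 0) : ∃ (c : ℕ → ℕ) (L : ℕ),
      (∀ i, (c i : ℤ) ≤ cfQuot ξ (2 * i + 2)) ∧ N = oddValue ξ c L := by
  induction N using Nat.strong_induction_on generalizing ξ with
  | _ N ih =>
  have hη := irrational_completeQuot hξ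
  have hζ := irrational_completeQuot hη
  have ha2 : 1 ≤ cfQuot ξ 2 := cfQuot_pos hξ 1
  rcases Nat.eq_zero_or_pos N with rfl | hNpos
  · refine ⟨0, 0, fun i => ?_, by simp [oddValue]⟩
    have : 1 ≤ cfQuot ξ (2 * i + 2) := cfQuot_pos hξ (2 * i + 1)
    rw [Pi.zero_apply]
    push_cast
    omega
  obtain ⟨K, M, b1, b2, hNK, hM⟩ := (detWalk_nonneg_and_zero hξ hev N).2 hN
  have hζ0 := completeQuot_pos hη
  have hMN : M < N := by
    have ha1 : 1 ≤ cfQuot ξ 1 := cfQuot_pos hξ 0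
    rcases Nat.eq_zero_or_pos K with rfl | hK
    · rcases Nat.eq_zero_or_pos M with rfl | hM0
      · exact hNpos
      · have hMR : (0 : ℝ) < M := by positivity
        have := mul_pos hMR hζ0
        push_cast at b1
        linarith
    · have : 0 < cfQuot ξ 1 * (K : ℤ) := mul_pos (by omega) (by omega)
      omega
  obtain ⟨c', L, hc', rfl⟩ := ih M hMN hζ (hev.shift hξ) hM
  obtain ⟨i1, i2, -⟩ := oddValue_bounds_and_zero hζ (hev.shift hξ) hc' L
  set ζ := completeQuot (completeQuot ξ) with hζdef
  set M := oddValue ζ c' L with hMdef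
  set K' := evenValue (completeQuot ζ) c' L with hK'def
  have hζe : ζ = cfQuot ξ 2 + Int.fract ζ := cfQuot_two_add_fract hξ
  have hy1 := Int.fract_lt_one ζ
  -- This is the digit of `q_1`. The bounds on `K` and `K'` confine it to the open interval from
  -- `-1` to `a_2 + 1`, and integrality does the rest.
  obtain ⟨d, hd⟩ : ∃ d : ℤ, d = K - cfQuot ξ 2 * M - K' := ⟨_, rfl⟩
  have hdR : (d : ℝ) = K - cfQuot ξ 2 * M - K' := by rw [hd]; push_cast; ring
  rw [hζe] at b1 b2
  have hd0 : 0 ≤ d := by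
    have : (-1 : ℝ) < d := by linarith
    have : (-1 : ℤ) < d := by exact_mod_cast this
    omega
  have hd1 : d ≤ cfQuot ξ 2 := by
    have : (d : ℝ) < cfQuot ξ 2 + 1 := by linarith
    have : d < cfQuot ξ 2 + 1 := by exact_mod_cast this
    omega
  lift d to ℕ using hd0
  refine ⟨fun i => Nat.casesOn i d c', L + 1, fun i => ?_, ?_⟩
  · rcases i with _ | i
    · exact hd1
    · have := hc' i
      rw [hζdef, ← cfQuot_succ hη, ← cfQuot_succ hξ] at this
      exact this
  · have e1 := oddValue_succ hξ (fun i => Nat.casesOn i d c') L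
    have e2 := evenValue_succ hη (fun i => Nat.casesOn i d c') L
    rw [← cfQuot_succ hξ] at e2
    simp only [← hζdef] at e1 e2
    rw [e2] at e1
    zify
    rw [e1, hNK]
    have hKd : (K : ℤ) = d + cfQuot ξ 2 * M + K' := by linarith
    rw [hKd]
    rfl

theorem sum_range_two_mul_odd (f : ℕ → ℕ) (hf : ∀ i, Even i → f i = 0) (L : ℕ) :
    ∑ i ∈ Finset.range (2 * L), f i = ∑ i ∈ Finset.range L, f (2 * i + 1) := by
  induction L with
  | zero => simp
  | succ L ih =>
    rw [show 2 * (L + 1) = 2 * L + 1 + 1 by ring, Finset.sum_range_succ, Finset.sum_range_succ,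
      Finset.sum_range_succ, ih, hf (2 * L) (even_two_mul L), add_zero]

/-- The zeros of the walk are the numbers all of whose digits in even positions vanish. -/
theorem detWalk_eq_zero_iff {ξ : ℝ} (hξ : Irrational ξ) (hBR : IsBRNumber ξ) {N : ℕ}
    {b : ℕ →₀ ℕ} (hb : IsOstrowskiRep ξ b N) :
    detWalk (2 * ξ) N = 0 ↔ ∀ i, Even i → b i = 0 := by
  have hev : HasEvenOddQuots ξ := even_cfQuot_of_isBRNumber hξ hBR
  constructor
  · intro hN
    obtain ⟨c, L, hc, hNc⟩ := exists_oddValue_of_zero hξ hev hN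
    -- The digits `c` are spread over the odd positions. Every nonzero digit then has a zero below
    -- it, so the Ostrowski carry condition is automatic.
    let f : ℕ → ℕ := fun i => if Odd i ∧ i < 2 * L then c (i / 2) else 0
    have hfe : ∀ i, Even i → f i = 0 := fun i hi => by
      simp [f, Nat.not_odd_iff_even.2 hi]
    have hfL : ∀ i, 2 * L ≤ i → f i = 0 := fun i hi => by
      simp [f, Nat.not_lt.2 hi]
    have hfo : ∀ i < L, f (2 * i + 1) = c i := fun i hi => by
      have h1 : Odd (2 * i + 1) := odd_two_mul_add_one i
      have h2 : 2 * i + 1 < 2 * L := by omega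
      have h3 : (2 * i + 1) / 2 = i := by omega
      simp only [f, h1, h2, h3, and_self, if_true]
    let g : ℕ →₀ ℕ := Finsupp.onFinset (Finset.range (2 * L)) f fun i hi => by
      by_contra h
      exact hi (hfL i (by simpa using h))
    have hg : ∀ i, g i = f i := fun _ => rfl
    have hrep : IsOstrowskiRep ξ g N := by
      refine ⟨?_, fun i hi => ?_, fun i hi h => ?_, ?_⟩
      · rw [hg, hfe 0 (by simp)]
        have : 1 ≤ cfQuot ξ 1 := cfQuot_pos hξ 0
        push_cast
        omega
      · have := cfQuot_pos hξ i
        rw [hg]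
        by_cases h : Odd i ∧ i < 2 * L
        · obtain ⟨⟨j, rfl⟩, h2⟩ := h
          rw [hfo j (by omega)]
          exact hc j
        · simp only [f, h, if_false]
          push_cast
          omega
      · rw [hg] at h ⊢
        rcases Nat.even_or_odd i with hi' | hi'
        · rw [hfe i hi'] at h
          have := cfQuot_pos hξ i
          push_cast at h
          omega
        · exact hfe _ (Nat.Odd.sub_odd hi' odd_one)
      · have hs : g.sum (fun i d => d * cfDen ξ i) =
            ∑ i ∈ Finset.range (2 * L), f i * cfDen ξ i :=
          Finsupp.sum_of_support_subset _ Finsupp.support_onFinset_subset _ (by simp)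
        rw [hs, sum_range_two_mul_odd _ fun i hi => by rw [hfe i hi, zero_mul], hNc, oddValue]
        exact Finset.sum_congr rfl fun i hi => by rw [hfo i (Finset.mem_range.1 hi)]
    intro i hi
    rw [ostrowski_unique hξ hb hrep, hg, hfe i hi]
  · intro h
    have hsum : N = oddValue ξ (fun i => b (2 * i + 1)) (b.support.sup id + 1) := by
      have hz : ∀ i, 2 * (b.support.sup id + 1) ≤ i → b i = 0 := fun i hi => by
        by_contra hne
        have := Finset.le_sup (f := id) (Finsupp.mem_support_iff.2 hne)
        simp only [id] at this
        omega
      rw [ostrowski_sum_range hb hz, oddValue,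
        sum_range_two_mul_odd _ fun i hi => by rw [h i hi, zero_mul]]
    rw [hsum]
    exact (oddValue_bounds_and_zero hξ hev (fun i => hb.digit_le (2 * i + 1) (by omega)) _).2.2

/-! ### The automaton -/

/-- The automaton that accepts the words with vanishing letters in the even positions, counted
from the right. The two components of a state tell whether all letters read so far in positions
of the parity of the last one, and of the other parity, vanish. -/
def evenPositionsDFA : DFA ℕ (Bool × Bool) where
  step s d := (decide (d = 0) && s.2, s.1)
  start := (true, true)
  accept := {s | s.1 = true}

/-- Appending a letter moves all earlier letters up one position and exchanges the parities. The two
components must therefore be tracked together. -/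
theorem evenPositionsDFA_eval (w : List ℕ) :
    ((evenPositionsDFA.eval w).1 = true ↔ ∀ i, Even i → w.reverse.getD i 0 = 0) ∧
    ((evenPositionsDFA.eval w).2 = true ↔ ∀ i, Odd i → w.reverse.getD i 0 = 0) := by
  induction w using List.reverseRecOn with
  | nil => simp [evenPositionsDFA]
  | append_singleton w d ih =>
    rw [DFA.eval_append_singleton, List.reverse_append]
    simp only [List.reverse_singleton, List.singleton_append]
    constructor
    · simp only [evenPositionsDFA, Bool.and_eq_true, decide_eq_true_eq]
      refine Iff.trans (and_congr_right' ih.2) ⟨?_, fun h => ⟨by simpa using h 0, fun i hi => ?_⟩⟩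
      · rintro ⟨h0, h1⟩ i hi
        rcases i with _ | i
        · simpa using h0
        · simpa using h1 i (Nat.not_even_iff_odd.1 (Nat.even_add_one.1 hi))
      · simpa using h (i + 1) hi.add_one
    · refine ih.1.trans ⟨fun h i hi => ?_, fun h i hi => ?_⟩
      · rcases i with _ | i
        · simp at hi
        · simpa using h i (Nat.not_odd_iff_even.1 (Nat.odd_add_one.1 hi))
      · simpa using h (i + 1) hi.add_one

theorem mem_accepts_evenPositionsDFA (w : List ℕ) :
    w ∈ evenPositionsDFA.accepts ↔ EvenPositionsZero w := by
  rw [DFA.mem_accepts]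
  exact (evenPositionsDFA_eval w).1

theorem getD_reverse_msdWord {b : ℕ → ℕ} {L : ℕ} (hb : ∀ i, L ≤ i → b i = 0) (i : ℕ) :
    (msdWord b L).reverse.getD i 0 = b i := by
  rw [msdWord, List.reverse_reverse]
  rcases lt_or_ge i L with h | h
  · simp [List.getD_eq_getElem?_getD, h]
  -- Beyond the word, the default value `0` agrees with the vanishing digit.
  · simp [List.getD_eq_getElem?_getD, Nat.not_lt.2 h, hb i h]

theorem ostrowskiDecides_evenPositionsDFA {ξ : ℝ} (hξ : Irrational ξ) (hBR : IsBRNumber ξ) :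
    OstrowskiDecides ξ evenPositionsDFA {n : ℕ | detWalk (2 * ξ) n = 0} := by
  intro N b L hb hL
  rw [mem_accepts_evenPositionsDFA, Set.mem_ofPred_eq, detWalk_eq_zero_iff hξ hBR hb]
  simp only [EvenPositionsZero, getD_reverse_msdWord hL]

theorem mainTheorem11 (ξ : ℝ) (hξ : Irrational ξ) (hBR : IsBRNumber ξ) :
    IsOstrowskiAutomatic ξ {n : ℕ | detWalk (2 * ξ) n = 0} ∧
    ∃ (σ : Type) (_ : Finite σ) (M : DFA ℕ σ),
      (∀ w : List ℕ, w ∈ M.accepts ↔ EvenPositionsZero w) ∧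
      OstrowskiDecides ξ M {n : ℕ | detWalk (2 * ξ) n = 0} := by
  exact ⟨⟨_, inferInstance, evenPositionsDFA, ostrowskiDecides_evenPositionsDFA hξ hBR⟩,
    _, inferInstance, evenPositionsDFA, mem_accepts_evenPositionsDFA,
    ostrowskiDecides_evenPositionsDFA hξ hBR⟩
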